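/- Let $n\ge 1$, let $z_1,\ldots,z_n$ and $w_1,\ldots,w_{n-1}$ be complex numbers (not necessarily distinct), and let $p(z)=\prod_{i=1}^{n}(z-z_i)$ and $q(z)=n\prod_{j=1}^{n-1}(z-w_j)$. For $\alpha\in\mathbf{C}$ and $1\le k\le n-1$ define the following unordered $\binom{n}{k}$-tuple and $\binom{n-1}{k}$-tuple, respectively, of complex numbers: $$Z(\alpha,k)=\Big(\prod_{j=1}^{k}(z_{i_j}-\alpha)\Big)_{1\le i_1<\cdots<i_k\le n},\qquad W(\alpha,k)=\Big(\prod_{j=1}^{k}(w_{i_j}-\alpha)\Big)_{1\le i_1<\cdots<i_k\le n-1}.$$ For tuples $X=(x_1,\ldots,x_M)$ and $Y=(y_1,\ldots,y_N)$ of complex numbers with $M\le N$, write $X\prec Y$ ($X$ is majorized by $Y$) if there is a rectangularly stochastic $M\times N$ matrix $R$ with $X=RY$, that is, a real matrix $R=(r_{ij})$ with $r_{ij}\ge 0$, $\sum_{j=1}^{N}r_{ij}=1$ for all $i$, $\sum_{i=1}^{M}r_{ij}=M/N$ for all $j$, and $x_i=\sum_{j=1}^{N}r_{ij}y_j$ for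 all $i$. Then the following conditions are equivalent: (i) $q(z)=p'(z)$ for any $z\in\mathbf{C}$. (ii) For any $\alpha\in\mathbf{C}$ and $1\le k\le n-1$ one has $W(\alpha,k)\prec Z(\alpha,k)$. (iii) For $1\le k\le n-1$ one has $W(0,k)\prec Z(0,k)$. (iv) For any convex function $f:\mathbf{C}\to\mathbf{R}$, any $\alpha\in\mathbf{C}$ and $1\le k\le n-1$ one has $$\frac{1}{\binom{n-1}{k}}\sum_{1\le i_1<\cdots<i_k\le n-1}f\Big(\prod_{j=1}^{k}(w_{i_j}-\alpha)\Big)\le\frac{1}{\binom{n}{k}}\sum_{1\le i_1<\cdots<i_k\le n}f\Big(\prod_{j=1}^{k}(z_{i_j}-\alpha)\Big).$$ (v) The inequalities in (iv) hold for $\alpha=0$, that is, for any convex function $f:\mathbf{C}\to\mathbf{R}$ and $1\le k\le n-1$ one has $$\frac{1}{\binom{n-1}{k}}\sum_{1\le i_1<\cdots<i_k\le n-1}f\Big(\prod_{j=1}^{k}w_{i_j}\Big)\le\frac{1}{\binom{n}{k}}\sum_{1\le i_1<\cdots<i_k\le n}f\Big(\prod_{j=1}^{k}z_{i_j}\Big).$$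 -/

import Mathlib

/-- A real matrix with rows indexed by `ι` and columns indexed by `κ` (say `m` rows and `n`
columns, `m ≤ n`) is rectangularly stochastic if its entries are nonnegative, every row sums
to `1`, and every column sums to `m / n`. -/
structure IsRectStochastic {ι κ : Type*} [Fintype ι] [Fintype κ] (R : Matrix ι κ ℝ) : Prop where
  card_le : Fintype.card ι ≤ Fintype.card κ
  nonneg : ∀ i j, 0 ≤ R i j
  row_sum : ∀ i, ∑ j, R i j = 1
  col_sum : ∀ j, ∑ i, R i j = (Fintype.card ι : ℝ) / (Fintype.card κ : ℝ)

/-- Multivariate majorization `X ≺ Y` of finite families of vectors of a real vector space: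
`X = R Y` for some rectangularly stochastic matrix `R`. Families are indexed by arbitrary finite
types, and the notion does not change when either family is reindexed. -/
def IsMajorizedBy {ι κ E : Type*} [Fintype ι] [Fintype κ] [AddCommGroup E] [Module ℝ E]
    (X : ι → E) (Y : κ → E) : Prop :=
  ∃ R : Matrix ι κ ℝ, IsRectStochastic R ∧ ∀ i, X i = ∑ j, R i j • Y j

/-- The family of all products `∏ i ∈ s, (x i - α)`, where `s` runs over the `k`-element subsets
of the index set of the tuple `x`. -/
def shiftedProducts {m : ℕ} (x : Fin m → ℂ) (α : ℂ) (k : ℕ) :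
    Finset.powersetCard k (Finset.univ : Finset (Fin m)) → ℂ :=
  fun s => ∏ i ∈ s.1, (x i - α)

/-!
The inequalities force the derivative because real-linear functionals and their negatives are
convex: the real and imaginary parts of the averages of the `k`-fold products agree, so the
elementary symmetric means of `w` and `z` coincide, and these determine the coefficients of `p'`
(`derivative_eq_of_esymm_averages`). Majorization gives the inequalities by Jensen
(`IsMajorizedBy.sum_convex_le`).

For the passage from the derivative to majorization (`isMajorizedBy_of_derivative`), compress the
normal matrix `diagonal z` to the orthogonal complement of the all-ones vector. With the columns of
`U` an orthonormal basis of this complement, `U * Uᴴ = 1 - E / n`, where `E` is the all-ones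
matrix, and the characteristic polynomial of `Uᴴ * diagonal z * U` is `p' / n`
(`charpoly_compression`). Hence Schur triangularization with a prescribed order of the eigenvalues
(`exists_schur_triangularization`) changes `U` into `W` for which `Wᴴ * diagonal z * W` is upper
triangular with diagonal `w`. The matrix with entries `|det W_{J,I}| ^ 2`, where `I` and `J` run
over the `k`-element sets of columns and rows, is then the required stochastic matrix, by three
applications of the Cauchy–Binet formula (`det_mul_eq_sum_minors`):
* summing over `J` with the weights `∏ i ∈ J, (z i - α)` gives a principal minor of
  `Wᴴ * diagonal (z - α) * W`, which is triangular, so that minor is `∏ j ∈ I, (w j - α)`;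
* summing over `J` without weights gives a principal minor of `Wᴴ * W = 1`;
* summing over `I` gives a principal `k × k` minor of `W * Wᴴ = 1 - E / n`, which is
  `1 - k / n = (n - 1).choose k / n.choose k`.
-/

/-! ### The Cauchy–Binet formula -/

/-- The increasing enumeration of a `k`-element subset of `Fin N`. -/
def subsetEnum {N k : ℕ} (s : Finset.powersetCard k (Finset.univ : Finset (Fin N))) :
    Fin k ↪o Fin N :=
  s.1.orderEmbOfFin (Finset.mem_powersetCard.1 s.2).2

theorem image_subsetEnum {N k : ℕ} (s : Finset.powersetCard k (Finset.univ : Finset (Fin N))) :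
    Finset.univ.image (subsetEnum s) = s.1 :=
  Finset.image_orderEmbOfFin_univ _ _

theorem prod_subsetEnum {R : Type*} [CommMonoid R] {N k : ℕ}
    (s : Finset.powersetCard k (Finset.univ : Finset (Fin N))) (f : Fin N → R) :
    ∏ i, f (subsetEnum s i) = ∏ j ∈ s.1, f j := by
  rw [← image_subsetEnum s, Finset.prod_image fun _ _ _ _ h => (subsetEnum s).injective h]

/-- The expansion of `det (A * B)` by multilinearity in the rows. -/
theorem det_mul_eq_sum_functions {R m n : Type*} [CommRing R] [Fintype m] [DecidableEq m]
    [Fintype n] (A : Matrix m n R) (B : Matrix n m R) :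
    (A * B).det = ∑ f : m → n, (∏ i, A i (f i)) * (B.submatrix f id).det := by
  have h : A * B = fun i => ∑ j, A i j • B j := by
    ext i j
    simp [Matrix.mul_apply]
  rw [h]
  refine ((Matrix.detRowAlternating (R := R) (n := m)).toMultilinearMap.map_sum
    fun i j => A i j • B j).trans (Finset.sum_congr rfl fun f _ => ?_)
  exact (MultilinearMap.map_smul_univ _ (fun i => A i (f i)) fun i => B (f i))

/-- The **Cauchy–Binet formula**. -/
theorem det_mul_eq_sum_minors {R : Type*} [CommRing R] {N k : ℕ}
    (A : Matrix (Fin k) (Fin N) R) (B : Matrix (Fin N) (Fin k) R) :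
    (A * B).det = ∑ s : Finset.powersetCard k (Finset.univ : Finset (Fin N)),
      (A.submatrix id (subsetEnum s)).det * (B.submatrix (subsetEnum s) id).det := by
  rw [det_mul_eq_sum_functions]
  have h : ∀ s : Finset.powersetCard k (Finset.univ : Finset (Fin N)),
      (A.submatrix id (subsetEnum s)).det * (B.submatrix (subsetEnum s) id).det =
        ∑ σ : Equiv.Perm (Fin k), (∏ i, A i (subsetEnum s (σ i))) *
          (B.submatrix (fun i => subsetEnum s (σ i)) id).det := by
    intro s
    rw [← Matrix.det_transpose (A.submatrix _ _), Matrix.det_apply', Finset.sum_mul]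
    refine Finset.sum_congr rfl fun σ _ => ?_
    have := Matrix.det_permute σ (B.submatrix (subsetEnum s) id)
    rw [Matrix.submatrix_submatrix] at this
    simp only [Matrix.transpose_apply, Matrix.submatrix_apply, id]
    rw [mul_comm (_ : R) (∏ i, _), mul_assoc, ← this]
    rfl
  simp_rw [h]
  rw [← Fintype.sum_prod_type'
    (f := fun (s : Finset.powersetCard k (Finset.univ : Finset (Fin N)))
      (σ : Equiv.Perm (Fin k)) => (∏ i, A i (subsetEnum s (σ i))) *
        (B.submatrix (fun i => subsetEnum s (σ i)) id).det)]
  symm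
  refine Finset.sum_of_injOn (fun x i => subsetEnum x.1 (x.2 i)) ?_ ?_ ?_ ?_
  · rintro ⟨s, σ⟩ _ ⟨t, τ⟩ _ hst
    replace hst : ∀ i, subsetEnum s (σ i) = subsetEnum t (τ i) := congr_fun hst
    have hs : s = t := by
      apply Subtype.ext
      rw [← image_subsetEnum s, ← image_subsetEnum t]
      ext j
      simp only [Finset.mem_image, Finset.mem_univ, true_and]
      constructor
      · rintro ⟨i, rfl⟩
        exact ⟨τ (σ.symm i), by rw [← hst, Equiv.apply_symm_apply]⟩
      · rintro ⟨i, rfl⟩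
        exact ⟨σ (τ.symm i), by rw [hst, Equiv.apply_symm_apply]⟩
    subst hs
    refine Prod.ext rfl (Equiv.ext fun i => (subsetEnum s).injective (hst i))
  · exact fun _ _ => Finset.mem_coe.2 (Finset.mem_univ _)
  · intro f _ hf
    by_cases hinj : Function.Injective f
    · -- An injective `f` is the enumeration of its image composed with a permutation.
      exfalso
      apply hf
      let s : Finset.powersetCard k (Finset.univ : Finset (Fin N)) :=
        ⟨Finset.univ.image f, Finset.mem_powersetCard.2 ⟨Finset.subset_univ _, by
          rw [Finset.card_image_of_injective _ hinj, Finset.card_univ, Fintype.card_fin]⟩⟩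
      have hex : ∀ i, ∃ j, subsetEnum s j = f i := by
        intro i
        have : f i ∈ Finset.univ.image (subsetEnum s) := by
          rw [image_subsetEnum]
          exact Finset.mem_image_of_mem _ (Finset.mem_univ _)
        simpa using this
      choose σ hσ using hex
      have hσi : Function.Injective σ := fun a b hab => hinj (by rw [← hσ, ← hσ, hab])
      refine ⟨(s, Equiv.ofBijective σ (Finite.injective_iff_bijective.1 hσi)),
        Finset.mem_coe.2 (Finset.mem_univ _), funext hσ⟩
    · obtain ⟨a, b, hab, hne⟩ : ∃ a b, f a = f b ∧ a ≠ b := by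
        simpa [Function.Injective] using hinj
      rw [Matrix.det_zero_of_row_eq hne (by ext j; simp [hab]), mul_zero]
  · exact fun _ _ => rfl

/-! ### Schur triangularization -/

open Matrix in
/-- Every unit vector is the first column of a unitary matrix. -/
theorem exists_unitary_column_zero {m : ℕ} (v : EuclideanSpace ℂ (Fin (m + 1))) (hv : ‖v‖ = 1) :
    ∃ V ∈ unitaryGroup (Fin (m + 1)) ℂ, ∀ i, V i 0 = v i := by
  have hon : Orthonormal ℂ (({0} : Set (Fin (m + 1))).domRestrict fun _ => v) := by
    refine ⟨fun _ => hv, fun i j hij => absurd (Subsingleton.elim i j) hij⟩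
  obtain ⟨b, hb⟩ := hon.exists_orthonormalBasis_extension_of_card_eq (by simp)
  refine ⟨of fun i j => b j i, ?_, fun i => by simp [hb 0 rfl]⟩
  rw [mem_unitaryGroup_iff']
  ext i j
  have h := orthonormal_iff_ite.1 b.orthonormal i j
  rw [EuclideanSpace.inner_eq_star_dotProduct, dotProduct_comm] at h
  rw [one_apply, ← h]
  rfl

open Matrix Polynomial in
theorem charpoly_of_column_zero {m : ℕ} (M : Matrix (Fin (m + 1)) (Fin (m + 1)) ℂ)
    (h : ∀ i : Fin m, M i.succ 0 = 0) :
    M.charpoly = (X - C (M 0 0)) * (M.submatrix Fin.succ Fin.succ).charpoly := by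
  rw [charpoly, det_succ_column_zero, Fin.sum_univ_succ]
  rw [Finset.sum_eq_zero]
  · have : M.charmatrix.submatrix (Fin.succAbove 0) Fin.succ =
        (M.submatrix Fin.succ Fin.succ).charmatrix := by
      ext1 i j
      simp [charmatrix_apply, diagonal_apply]
    rw [this, charpoly]
    simp
  · intro i _
    simp [h, Fin.succ_ne_zero]

open Matrix Polynomial in
theorem charpoly_unitary_conj {n : Type*} [Fintype n] [DecidableEq n] (M V : Matrix n n ℂ)
    (hV : V ∈ unitaryGroup n ℂ) : (star V * M * V).charpoly = M.charpoly := by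
  rw [mul_assoc, charpoly_mul_comm, mul_assoc, mem_unitaryGroup_iff.1 hV, mul_one]

open Matrix Polynomial in
/-- **Schur triangularization**: a complex matrix is unitarily similar to an upper triangular one
whose diagonal lists the eigenvalues in any prescribed order. -/
theorem exists_schur_triangularization {m : ℕ} (M : Matrix (Fin m) (Fin m) ℂ) (d : Fin m → ℂ)
    (h : M.charpoly = ∏ i, (X - C (d i))) :
    ∃ Q ∈ unitaryGroup (Fin m) ℂ, (star Q * M * Q).IsUpperTriangular ∧
      ∀ i, (star Q * M * Q) i i = d i := by
  induction m with
  | zero => exact ⟨1, one_mem _, fun i => i.elim0, fun i => i.elim0⟩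
  | succ m ih =>
    -- A unit eigenvector for the eigenvalue `d 0`.
    obtain ⟨u, hu0, hu⟩ : ∃ u, u ≠ 0 ∧ (scalar (Fin (m + 1)) (d 0) - M).mulVec u = 0 := by
      rw [exists_mulVec_eq_zero_iff, ← eval_charpoly, h, eval_prod]
      exact Finset.prod_eq_zero (Finset.mem_univ 0) (by simp)
    rw [sub_mulVec, sub_eq_zero] at hu
    have hMu : M.mulVec u = d 0 • u := by
      rw [← hu]; ext i; simp [scalar_apply, mulVec_diagonal]
    let u' : EuclideanSpace ℂ (Fin (m + 1)) := WithLp.toLp 2 u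
    have hu' : u' ≠ 0 := fun h0 => hu0 (by simpa [u'] using h0)
    obtain ⟨V, hV, hV0⟩ := exists_unitary_column_zero ((‖u'‖⁻¹ : ℂ) • u') (by
      rw [norm_smul, norm_inv, Complex.norm_real, norm_norm,
        inv_mul_cancel₀ (norm_ne_zero_iff.2 hu')])
    have hcol : ∀ i, (M * V) i 0 = d 0 * V i 0 := by
      intro i
      have h1 := congr_fun hMu i
      simp only [mulVec, dotProduct, Pi.smul_apply, smul_eq_mul] at h1
      simp only [mul_apply, hV0, PiLp.smul_apply, smul_eq_mul, u']
      rw [mul_left_comm, ← h1, Finset.mul_sum]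
      exact Finset.sum_congr rfl fun j _ => by ring
    set N := star V * M * V with hN
    have hN0 : ∀ i, N i 0 = if i = 0 then d 0 else 0 := by
      intro i
      have h1 : (star V * V) i 0 = if i = 0 then 1 else 0 := by
        rw [mem_unitaryGroup_iff'.1 hV, one_apply]
      rw [hN, mul_assoc, mul_apply]
      simp_rw [hcol, mul_left_comm _ (d 0)]
      rw [← Finset.mul_sum, ← mul_apply, h1]
      split_ifs <;> simp
    have hchar : (N.submatrix Fin.succ Fin.succ).charpoly = ∏ i : Fin m, (X - C (d i.succ)) := by
      have h1 := charpoly_of_column_zero N fun i => by simp [hN0, Fin.succ_ne_zero]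
      rw [hN, charpoly_unitary_conj _ _ hV, ← hN, h, Fin.prod_univ_succ, hN0, if_pos rfl] at h1
      exact (mul_left_cancel₀ (X_sub_C_ne_zero _) h1).symm
    obtain ⟨Q, hQ, hQt, hQd⟩ := ih _ _ hchar
    -- The block matrix `1 ⊕ Q`.
    let B : Matrix (Fin (m + 1)) (Fin (m + 1)) ℂ :=
      of fun i j => Fin.cases (Fin.cases 1 (fun _ => 0) j) (fun i' => Fin.cases 0 (Q i') j) i
    have B00 : B 0 0 = 1 := rfl
    have B0s : ∀ j : Fin m, B 0 j.succ = 0 := fun _ => rfl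
    have Bs0 : ∀ i : Fin m, B i.succ 0 = 0 := fun _ => rfl
    have Bss : ∀ i j : Fin m, B i.succ j.succ = Q i j := fun _ _ => rfl
    have hB : B ∈ unitaryGroup (Fin (m + 1)) ℂ := by
      rw [mem_unitaryGroup_iff'] at hQ ⊢
      ext i j
      have hq := fun i j => congr_fun₂ hQ i j
      simp only [mul_apply, star_apply] at hq
      refine Fin.cases ?_ (fun i => ?_) i <;> refine Fin.cases ?_ (fun j => ?_) j <;>
        simp [mul_apply, star_apply, Fin.sum_univ_succ, B00, B0s, Bs0, Bss, one_apply,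
          Fin.succ_ne_zero, (Fin.succ_ne_zero _).symm]
      simpa [one_apply] using hq i j
    have hT : star (V * B) * M * (V * B) = star B * N * B := by
      rw [hN, star_mul]; simp only [mul_assoc]
    have hT0 : ∀ i, (star B * N * B) i 0 = if i = 0 then d 0 else 0 := by
      intro i
      rw [mul_apply, Fin.sum_univ_succ]
      refine Fin.cases ?_ (fun i => ?_) i <;>
        simp [mul_apply, star_apply, Fin.sum_univ_succ, B00, B0s, Bs0, Bss, hN0, Fin.succ_ne_zero]
    have hTs : ∀ i j : Fin m, (star B * N * B) i.succ j.succ =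
        (star Q * N.submatrix Fin.succ Fin.succ * Q) i j := by
      intro i j
      simp [mul_apply, star_apply, Fin.sum_univ_succ, B0s, Bss]
    refine ⟨V * B, mul_mem hV hB, ?_, ?_⟩
    · rw [hT]
      intro i j hij
      induction j using Fin.cases with
      | zero =>
        rw [hT0, if_neg]
        rintro rfl
        exact lt_irrefl _ hij
      | succ j =>
        induction i using Fin.cases with
        | zero => exact absurd hij (Fin.not_lt_zero _)
        | succ i =>
          rw [hTs]
          exact hQt (Fin.succ_lt_succ_iff.1 hij)
    · rw [hT]
      intro i
      induction i using Fin.cases with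
      | zero => rw [hT0, if_pos rfl]
      | succ i => rw [hTs, hQd]

/-! ### Squared moduli of minors -/

/-- The matrix of squared moduli of the `k × k` minors of `W`, with rows indexed by the column
sets and columns indexed by the row sets of the minors. -/
def minorNormSq {N M : ℕ} (W : Matrix (Fin N) (Fin M) ℂ) (k : ℕ) :
    Matrix (Finset.powersetCard k (Finset.univ : Finset (Fin M)))
      (Finset.powersetCard k (Finset.univ : Finset (Fin N))) ℝ :=
  Matrix.of fun s t => Complex.normSq (W.submatrix (subsetEnum t) (subsetEnum s)).det

open Matrix in
/-- The diagonal entries of the compound matrix of `Wᴴ * diagonal c * W`. -/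
theorem sum_minorNormSq_mul_prod {N M k : ℕ} (W : Matrix (Fin N) (Fin M) ℂ) (c : Fin N → ℂ)
    (s : Finset.powersetCard k (Finset.univ : Finset (Fin M))) :
    ∑ t, (minorNormSq W k s t : ℂ) * ∏ i ∈ t.1, c i =
      ((Wᴴ * diagonal c * W).submatrix (subsetEnum s) (subsetEnum s)).det := by
  rw [submatrix_mul _ _ _ id _ Function.bijective_id, det_mul_eq_sum_minors]
  refine Finset.sum_congr rfl fun t _ => ?_
  rw [submatrix_submatrix, submatrix_submatrix]
  have h : (Wᴴ * diagonal c).submatrix (subsetEnum s ∘ id) (id ∘ subsetEnum t) =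
      (W.submatrix (subsetEnum t) (subsetEnum s))ᴴ * diagonal fun i => c (subsetEnum t i) := by
    ext i j
    simp
  rw [h, det_mul, det_diagonal, prod_subsetEnum t c, det_conjTranspose, minorNormSq,
    of_apply, Complex.normSq_eq_conj_mul_self, mul_right_comm]
  rfl

open Matrix in
/-- The diagonal entries of the compound matrix of `W * Wᴴ`. -/
theorem sum_minorNormSq_column {N M k : ℕ} (W : Matrix (Fin N) (Fin M) ℂ)
    (t : Finset.powersetCard k (Finset.univ : Finset (Fin N))) :
    ∑ s, (minorNormSq W k s t : ℂ) =
      ((W * Wᴴ).submatrix (subsetEnum t) (subsetEnum t)).det := by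
  rw [submatrix_mul _ _ _ id _ Function.bijective_id, det_mul_eq_sum_minors]
  refine Finset.sum_congr rfl fun s _ => ?_
  rw [submatrix_submatrix, submatrix_submatrix, ← conjTranspose_submatrix, det_conjTranspose,
    minorNormSq, of_apply, ← Complex.mul_conj]
  rfl

/-! ### Compressing a diagonal matrix to the complement of the all-ones vector -/

open Matrix in
/-- The columns of the matrix form an orthonormal basis of the complement of the all-ones
vector. -/
theorem exists_isometry_ones_compl (m : ℕ) :
    ∃ U : Matrix (Fin (m + 1)) (Fin m) ℂ, Uᴴ * U = 1 ∧
      U * Uᴴ = of fun i j => (if i = j then 1 else 0) - ((m + 1 : ℕ) : ℂ)⁻¹ := by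
  have hm : (0 : ℝ) < (m + 1 : ℕ) := by positivity
  obtain ⟨V, hV, hV0⟩ := exists_unitary_column_zero (m := m)
    (WithLp.toLp 2 fun _ => (((√((m + 1 : ℕ) : ℝ))⁻¹ : ℝ) : ℂ)) (by
      rw [EuclideanSpace.norm_eq, Real.sqrt_eq_one]
      simp only [Complex.norm_real, norm_inv, Real.norm_eq_abs, sq_abs, inv_pow,
        Real.sq_sqrt hm.le, Finset.sum_const, Finset.card_univ, Fintype.card_fin, nsmul_eq_mul]
      exact mul_inv_cancel₀ hm.ne')
  refine ⟨V.submatrix id Fin.succ, ?_, ?_⟩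
  · have h := mem_unitaryGroup_iff'.1 hV
    ext i j
    have h1 := congr_fun₂ h i.succ j.succ
    simpa [mul_apply, one_apply] using h1
  · have h := mem_unitaryGroup_iff.1 hV
    ext i j
    have h1 := congr_fun₂ h i j
    rw [mul_apply, Fin.sum_univ_succ, star_apply, hV0, hV0, one_apply] at h1
    have h2 : ((((√((m + 1 : ℕ) : ℝ))⁻¹ : ℝ) : ℂ)) * star (((√((m + 1 : ℕ) : ℝ))⁻¹ : ℝ) : ℂ) =
        ((m + 1 : ℕ) : ℂ)⁻¹ := by
      rw [← starRingEnd_apply, Complex.conj_ofReal, ← Complex.ofReal_mul, ← mul_inv,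
        Real.mul_self_sqrt hm.le]
      simp
    simp only at h1
    rw [h2] at h1
    rw [of_apply, ← h1, add_sub_cancel_left, mul_apply]
    rfl

open Matrix in
/-- The column sums come from the principal minors of a rank-one perturbation of the identity. -/
theorem sum_minorNormSq_ones_compl {m k : ℕ} (W : Matrix (Fin (m + 1)) (Fin m) ℂ)
    (hW : W * Wᴴ = of fun i j => (if i = j then 1 else 0) - ((m + 1 : ℕ) : ℂ)⁻¹)
    (t : Finset.powersetCard k (Finset.univ : Finset (Fin (m + 1)))) :
    ∑ s, minorNormSq W k s t = 1 - (k : ℝ) / (m + 1 : ℕ) := by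
  have h : (W * Wᴴ).submatrix (subsetEnum t) (subsetEnum t) =
      1 + replicateCol Unit (fun _ : Fin k => -((m + 1 : ℕ) : ℂ)⁻¹) *
        replicateRow Unit (fun _ => (1 : ℂ)) := by
    rw [hW]
    ext i j
    simp [one_apply, mul_apply, sub_eq_add_neg, (subsetEnum t).injective.eq_iff]
  have h1 := sum_minorNormSq_column W t
  rw [h, det_one_add_replicateCol_mul_replicateRow] at h1
  apply Complex.ofReal_injective
  rw [Complex.ofReal_sum, h1]
  simp [dotProduct]
  ring

open Matrix Polynomial in
/-- The characteristic polynomial of the compression of `diagonal z` to the complement of the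
all-ones vector is the normalized derivative of the characteristic polynomial of `diagonal z`. -/
theorem charpoly_compression {m : ℕ} (z : Fin (m + 1) → ℂ) (U : Matrix (Fin (m + 1)) (Fin m) ℂ)
    (hU : Uᴴ * U = 1)
    (hU' : U * Uᴴ = of fun i j => (if i = j then 1 else 0) - ((m + 1 : ℕ) : ℂ)⁻¹) :
    C ((m + 1 : ℕ) : ℂ) * (Uᴴ * diagonal z * U).charpoly =
      derivative (∏ i, (X - C (z i))) := by
  have hm : ((m + 1 : ℕ) : ℂ) ≠ 0 := Nat.cast_ne_zero.2 m.succ_ne_zero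
  apply Polynomial.funext
  intro x
  -- For `k = m` the only column set is the whole of `Fin m`.
  let s : Finset.powersetCard m (Finset.univ : Finset (Fin m)) :=
    ⟨Finset.univ, Finset.mem_powersetCard.2 ⟨le_rfl, by simp⟩⟩
  have hs : ∀ s', s' = s := fun s' => Subtype.ext
    (Finset.eq_univ_of_card _ (by rw [(Finset.mem_powersetCard.1 s'.2).2, Fintype.card_fin]))
  have hbij : Function.Bijective (subsetEnum s) :=
    Finite.injective_iff_bijective.1 (subsetEnum s).injective
  have h1 := sum_minorNormSq_mul_prod U (fun i => x - z i) s
  have h2 : Uᴴ * diagonal (fun i => x - z i) * U =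
      scalar (Fin m) x - Uᴴ * diagonal z * U := by
    have : (diagonal fun i => x - z i) = x • (1 : Matrix (Fin (m + 1)) (Fin (m + 1)) ℂ) -
        diagonal z := by
      ext i j
      by_cases hij : i = j <;> simp [hij]
    rw [this, Matrix.mul_sub, Matrix.sub_mul, Matrix.mul_smul, Matrix.mul_one, Matrix.smul_mul, hU]
    simp [smul_one_eq_diagonal]
  have h3 := det_submatrix_equiv_self (Equiv.ofBijective _ hbij) (scalar (Fin m) x -
    Uᴴ * diagonal z * U)
  rw [Equiv.coe_ofBijective] at h3
  rw [h2, h3] at h1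
  have h4 : ∀ t, (minorNormSq U m s t : ℂ) = ((m + 1 : ℕ) : ℂ)⁻¹ := by
    intro t
    have h := sum_minorNormSq_ones_compl U hU' t
    rw [Fintype.sum_eq_single s fun s' hs' => absurd (hs s') hs'] at h
    rw [h]
    push_cast at hm ⊢
    field_simp
    ring
  simp_rw [h4, ← Finset.mul_sum] at h1
  rw [eval_mul, eval_C, eval_charpoly, ← h1, mul_inv_cancel_left₀ hm, derivative_prod_finset,
    eval_finsetSum, Finset.univ_eq_attach,
    Finset.sum_attach (Finset.powersetCard m Finset.univ) fun t => ∏ i ∈ t, (x - z i)]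
  -- The `m`-element subsets are the complements of the singletons.
  symm
  refine Finset.sum_bij (fun i _ => Finset.univ.erase i) ?_ ?_ ?_ ?_
  · intro i _
    simp [Finset.mem_powersetCard, Finset.card_erase_of_mem]
  · intro i _ j _ hij
    by_contra hne
    exact Finset.notMem_erase i _ (hij.symm ▸ Finset.mem_erase.2 ⟨hne, Finset.mem_univ i⟩)
  · intro t ht
    have hc : tᶜ.card = 1 := by
      rw [Finset.card_compl, (Finset.mem_powersetCard.1 ht).2, Fintype.card_fin]
      omega
    obtain ⟨i, hi⟩ := Finset.card_eq_one.1 hc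
    exact ⟨i, Finset.mem_univ i, by rw [← Finset.compl_singleton, ← hi, compl_compl]⟩
  · intro i _
    simp [eval_prod]

/-! ### Majorization -/

open Matrix Polynomial in
/-- The critical points `w` of `∏ i, (X - z i)` are the diagonal of a triangular form
`Wᴴ * diagonal z * W`, where the columns of `W` are an orthonormal basis of the complement of the
all-ones vector. The squared moduli of the minors of `W` form the required stochastic matrix,
which does not depend on `α`. -/
theorem isMajorizedBy_of_derivative {m : ℕ} (z : Fin (m + 1) → ℂ) (w : Fin m → ℂ)
    (h : C ((m + 1 : ℕ) : ℂ) * ∏ j, (X - C (w j)) = derivative (∏ i, (X - C (z i))))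
    (α : ℂ) {k : ℕ} (hk : k ≤ m) :
    IsMajorizedBy (shiftedProducts w α k) (shiftedProducts z α k) := by
  have hm : ((m + 1 : ℕ) : ℂ) ≠ 0 := Nat.cast_ne_zero.2 m.succ_ne_zero
  obtain ⟨U, hU, hU'⟩ := exists_isometry_ones_compl m
  have hchar : (Uᴴ * diagonal z * U).charpoly = ∏ j, (X - C (w j)) :=
    mul_left_cancel₀ (C_ne_zero.2 hm) ((charpoly_compression z U hU hU').trans h.symm)
  obtain ⟨Q, hQ, hQt, hQd⟩ := exists_schur_triangularization _ w hchar
  set T := star Q * (Uᴴ * diagonal z * U) * Q with hT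
  let W := U * Q
  have hQ1 : Qᴴ * Q = 1 := mem_unitaryGroup_iff'.1 hQ
  have hQ2 : Q * Qᴴ = 1 := mem_unitaryGroup_iff.1 hQ
  have hW : Wᴴ * W = 1 := by
    rw [conjTranspose_mul, Matrix.mul_assoc, ← Matrix.mul_assoc Uᴴ, hU, Matrix.one_mul, hQ1]
  have hW' : W * Wᴴ = of fun i j => (if i = j then 1 else 0) - ((m + 1 : ℕ) : ℂ)⁻¹ := by
    rw [conjTranspose_mul, Matrix.mul_assoc, ← Matrix.mul_assoc Q, hQ2, Matrix.one_mul, hU']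
  have hWT : Wᴴ * diagonal (fun i => z i - α) * W = T - α • 1 := by
    have h1 : (diagonal fun i => z i - α) =
        diagonal z - α • (1 : Matrix (Fin (m + 1)) (Fin (m + 1)) ℂ) := by
      ext i j
      by_cases hij : i = j <;> simp [hij]
    rw [h1, Matrix.mul_sub, Matrix.sub_mul, Matrix.mul_smul, Matrix.mul_one, Matrix.smul_mul, hW,
      hT, conjTranspose_mul, star_eq_conjTranspose]
    simp only [Matrix.mul_assoc]
    rfl
  refine ⟨minorNormSq W k, ⟨?_, fun _ _ => Complex.normSq_nonneg _, fun s => ?_, fun t => ?_⟩,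
    fun s => ?_⟩
  · simpa using Nat.choose_le_choose k m.le_succ
  · have h1 := sum_minorNormSq_mul_prod W (fun _ => 1) s
    rw [diagonal_one, Matrix.mul_one, hW, submatrix_one _ (subsetEnum s).injective, det_one] at h1
    apply Complex.ofReal_injective
    simpa using h1
  · rw [sum_minorNormSq_ones_compl W hW' t]
    have h1 : (m.choose k : ℝ) * (m + 1 : ℕ) = ((m + 1).choose k : ℝ) * ((m + 1 : ℕ) - k) := by
      rw [← Nat.cast_sub (by omega : k ≤ m + 1)]
      exact_mod_cast Nat.choose_mul_succ_eq m k
    have h2 : ((m + 1).choose k : ℝ) ≠ 0 :=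
      Nat.cast_ne_zero.2 (Nat.choose_pos (by omega)).ne'
    have h3 : ((m + 1 : ℕ) : ℝ) ≠ 0 := Nat.cast_ne_zero.2 m.succ_ne_zero
    simp only [Fintype.card_coe, Finset.card_powersetCard, Finset.card_univ, Fintype.card_fin]
    rw [one_sub_div h3, div_eq_div_iff h3 h2, h1, mul_comm]
  · have h1 := sum_minorNormSq_mul_prod W (fun i => z i - α) s
    have h2 : ((T - α • 1).submatrix (subsetEnum s) (subsetEnum s)).IsUpperTriangular := by
      intro i j hij
      have hne : i ≠ j := (ne_of_lt hij).symm
      have h3 : T (subsetEnum s i) (subsetEnum s j) = 0 := hQt ((subsetEnum s).lt_iff_lt.2 hij)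
      simp [h3, hne]
    rw [hWT, det_of_isUpperTriangular h2] at h1
    simp only [submatrix_apply, Matrix.sub_apply, Matrix.smul_apply, one_apply_eq, smul_eq_mul,
      mul_one, hQd] at h1
    rw [prod_subsetEnum s fun j => w j - α] at h1
    exact h1.symm

/-- Convex functions respect majorization: averaging Jensen's inequality over the rows. -/
theorem IsMajorizedBy.sum_convex_le {ι κ E : Type*} [Fintype ι] [Fintype κ] [Nonempty ι]
    [AddCommGroup E] [Module ℝ E] {x : ι → E} {y : κ → E} (h : IsMajorizedBy x y) {f : E → ℝ}
    (hf : ConvexOn ℝ Set.univ f) :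
    1 / (Fintype.card ι : ℝ) * ∑ i, f (x i) ≤ 1 / (Fintype.card κ : ℝ) * ∑ j, f (y j) := by
  obtain ⟨R, hR, hx⟩ := h
  have hι : (0 : ℝ) < Fintype.card ι := Nat.cast_pos.2 Fintype.card_pos
  have h1 : ∑ i, f (x i) ≤ (Fintype.card ι : ℝ) / (Fintype.card κ : ℝ) * ∑ j, f (y j) :=
    calc ∑ i, f (x i) ≤ ∑ i, ∑ j, R i j * f (y j) := Finset.sum_le_sum fun i _ => by
          rw [hx]
          exact hf.map_sum_le (fun j _ => hR.nonneg i j) (hR.row_sum i) fun _ _ => Set.mem_univ _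
      _ = (Fintype.card ι : ℝ) / (Fintype.card κ : ℝ) * ∑ j, f (y j) := by
          rw [Finset.sum_comm, Finset.mul_sum]
          exact Finset.sum_congr rfl fun j _ => by rw [← Finset.sum_mul, hR.col_sum]
  rw [one_div, inv_mul_le_iff₀ hι]
  exact h1.trans_eq (by ring)

theorem convex_average_le_of_isMajorizedBy {m : ℕ} (z : Fin (m + 1) → ℂ) (w : Fin m → ℂ)
    (α : ℂ) {k : ℕ} (hk : k ≤ m)
    (h : IsMajorizedBy (shiftedProducts w α k) (shiftedProducts z α k)) {f : ℂ → ℝ}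
    (hf : ConvexOn ℝ Set.univ f) :
    1 / (m.choose k : ℝ) * ∑ s ∈ Finset.powersetCard k (Finset.univ : Finset (Fin m)),
        f (∏ j ∈ s, (w j - α)) ≤
      1 / ((m + 1).choose k : ℝ) *
        ∑ s ∈ Finset.powersetCard k (Finset.univ : Finset (Fin (m + 1))),
          f (∏ i ∈ s, (z i - α)) := by
  have : Nonempty (Finset.powersetCard k (Finset.univ : Finset (Fin m))) :=
    (Finset.powersetCard_nonempty.2 (by simpa using hk)).coe_sort
  have h1 := h.sum_convex_le hf
  simp only [Fintype.card_coe, Finset.card_powersetCard, Finset.card_univ, Fintype.card_fin,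
    shiftedProducts] at h1
  rw [← Finset.sum_coe_sort _ fun s => f (∏ j ∈ s, (w j - α)),
    ← Finset.sum_coe_sort _ fun s => f (∏ j ∈ s, (z j - α))]
  exact h1

/-! ### Recovering the derivative from the convex inequalities -/

/-- Convex inequalities between weighted sums force equality of the sums themselves. -/
theorem average_eq_of_convex_average_le {ι κ : Type*} (s : Finset ι) (t : Finset κ) (a b : ℝ)
    (x : ι → ℂ) (y : κ → ℂ)
    (h : ∀ f : ℂ → ℝ, ConvexOn ℝ Set.univ f → a * ∑ i ∈ s, f (x i) ≤ b * ∑ j ∈ t, f (y j)) :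
    (a : ℂ) * ∑ i ∈ s, x i = b * ∑ j ∈ t, y j := by
  -- A real-linear functional and its negative are both convex.
  have key : ∀ l : ℂ →ₗ[ℝ] ℝ, a * ∑ i ∈ s, l (x i) = b * ∑ j ∈ t, l (y j) := by
    intro l
    refine le_antisymm (h l (l.convexOn convex_univ)) ?_
    have := h (-l) ((-l).convexOn convex_univ)
    simpa using this
  apply Complex.ext
  · simpa using key Complex.reLm
  · simpa using key Complex.imLm

open Polynomial in
/-- If the elementary symmetric means of `w` and `z` agree, then `w` lists the critical points of
`∏ i, (X - z i)`. -/
theorem derivative_eq_of_esymm_averages {m : ℕ} (z : Fin (m + 1) → ℂ) (w : Fin m → ℂ)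
    (h : ∀ k, 1 ≤ k → k ≤ m →
      ((1 / (m.choose k : ℝ) : ℝ) : ℂ) * ∑ s ∈ Finset.powersetCard k Finset.univ, ∏ j ∈ s, w j =
        ((1 / ((m + 1).choose k : ℝ) : ℝ) : ℂ) *
          ∑ s ∈ Finset.powersetCard k Finset.univ, ∏ i ∈ s, z i) :
    C ((m + 1 : ℕ) : ℂ) * ∏ j, (X - C (w j)) = derivative (∏ i, (X - C (z i))) := by
  have hw := Multiset.prod_X_sub_X_eq_sum_esymm ((Finset.univ : Finset (Fin m)).val.map w)
  have hz := Multiset.prod_X_sub_X_eq_sum_esymm ((Finset.univ : Finset (Fin (m + 1))).val.map z)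
  simp only [Finset.esymm_map_val, Multiset.map_map, Multiset.card_map, Finset.card_val,
    Finset.card_univ, Fintype.card_fin, Function.comp_def] at hw hz
  change ∏ j, (X - C (w j)) = _ at hw
  change ∏ i, (X - C (z i)) = _ at hz
  rw [hw, hz, derivative_sum, Finset.sum_range_succ _ (m + 1), Finset.mul_sum]
  have hlast : derivative ((-1) ^ (m + 1) * (C (∑ t ∈ Finset.powersetCard (m + 1) Finset.univ,
      ∏ i ∈ t, z i) * X ^ (m + 1 - (m + 1)))) = 0 := by
    rw [Nat.sub_self, pow_zero, mul_one, ← C_1, ← C_neg, ← C_pow, ← C_mul, derivative_C]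
  rw [hlast, add_zero]
  refine Finset.sum_congr rfl fun k hk => ?_
  have hkm : k ≤ m := Nat.lt_succ_iff.1 (Finset.mem_range.1 hk)
  have hk' : ((m + 1 : ℕ) : ℂ) * ∑ s ∈ Finset.powersetCard k Finset.univ, ∏ j ∈ s, w j =
      ((m + 1 - k : ℕ) : ℂ) * ∑ s ∈ Finset.powersetCard k Finset.univ, ∏ i ∈ s, z i := by
    rcases Nat.eq_zero_or_pos k with rfl | hk0
    · simp
    · have h1 := h k hk0 hkm
      have h2 : (m.choose k : ℂ) * (m + 1 : ℕ) = ((m + 1).choose k : ℂ) * (m + 1 - k : ℕ) := by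
        exact_mod_cast Nat.choose_mul_succ_eq m k
      have h3 : (m.choose k : ℂ) ≠ 0 := Nat.cast_ne_zero.2 (Nat.choose_pos hkm).ne'
      have h4 : ((m + 1).choose k : ℂ) ≠ 0 := Nat.cast_ne_zero.2 (Nat.choose_pos (by omega)).ne'
      push_cast only [Complex.ofReal_div, Complex.ofReal_one, Complex.ofReal_natCast] at h1
      field_simp at h1
      apply mul_left_cancel₀ h4
      linear_combination ((m + 1 : ℕ) : ℂ) * h1 + (∑ s ∈ Finset.powersetCard k Finset.univ,
        ∏ i ∈ s, z i) * h2
  have hsub : m + 1 - k = m - k + 1 := by omega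
  rw [← C_1, ← C_neg, ← C_pow, derivative_C_mul, derivative_C_mul, derivative_X_pow]
  rw [mul_left_comm, ← mul_assoc (C ((m + 1 : ℕ) : ℂ)), ← C_mul, hk', C_mul, hsub,
    Nat.add_sub_cancel]
  ring

/-! ### The equivalence -/

theorem theorem3p9 (n : ℕ) (hn : 1 ≤ n) (z : Fin n → ℂ) (w : Fin (n - 1) → ℂ)
    (p q : Polynomial ℂ)
    (hp : p = ∏ i, (Polynomial.X - Polynomial.C (z i)))
    (hq : q = Polynomial.C (n : ℂ) * ∏ j, (Polynomial.X - Polynomial.C (w j))) :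
    List.TFAE [
      ∀ x : ℂ, q.eval x = (Polynomial.derivative p).eval x,
      ∀ (α : ℂ) (k : ℕ), 1 ≤ k → k ≤ n - 1 →
        IsMajorizedBy (shiftedProducts w α k) (shiftedProducts z α k),
      ∀ k : ℕ, 1 ≤ k → k ≤ n - 1 →
        IsMajorizedBy (shiftedProducts w 0 k) (shiftedProducts z 0 k),
      ∀ f : ℂ → ℝ, ConvexOn ℝ Set.univ f → ∀ (α : ℂ) (k : ℕ), 1 ≤ k → k ≤ n - 1 →
        1 / ((n - 1).choose k : ℝ) *
            ∑ s ∈ Finset.powersetCard k (Finset.univ : Finset (Fin (n - 1))),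
              f (∏ j ∈ s, (w j - α)) ≤
          1 / (n.choose k : ℝ) *
            ∑ s ∈ Finset.powersetCard k (Finset.univ : Finset (Fin n)),
              f (∏ i ∈ s, (z i - α)),
      ∀ f : ℂ → ℝ, ConvexOn ℝ Set.univ f → ∀ k : ℕ, 1 ≤ k → k ≤ n - 1 →
        1 / ((n - 1).choose k : ℝ) *
            ∑ s ∈ Finset.powersetCard k (Finset.univ : Finset (Fin (n - 1))),
              f (∏ j ∈ s, (w j - 0)) ≤
          1 / (n.choose k : ℝ) *
            ∑ s ∈ Finset.powersetCard k (Finset.univ : Finset (Fin n)),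
              f (∏ i ∈ s, (z i - 0))] := by
  obtain ⟨m, rfl⟩ : ∃ m, n = m + 1 := ⟨n - 1, by omega⟩
  subst hp hq
  tfae_have 1 → 2 := fun h α k _ hk =>
    isMajorizedBy_of_derivative z w (Polynomial.funext h) α hk
  tfae_have 2 → 3 := fun h => h 0
  tfae_have 2 → 4 := fun h f hf α k h1 hk =>
    convex_average_le_of_isMajorizedBy z w α hk (h α k h1 hk) hf
  tfae_have 3 → 5 := fun h f hf k h1 hk =>
    convex_average_le_of_isMajorizedBy z w 0 hk (h k h1 hk) hf
  tfae_have 4 → 5 := fun h f hf => h f hf 0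
  tfae_have 5 → 1 := by
    intro h x
    refine congrArg (Polynomial.eval x) (derivative_eq_of_esymm_averages z w fun k h1 hk => ?_)
    have h2 := average_eq_of_convex_average_le _ _ _ _ _ _ fun f hf => h f hf k h1 hk
    simp only [sub_zero] at h2
    exact h2
  tfae_finish
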